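/- Let $R$ be an associative ring with unit. An $\mathcal R$-module is a covariant additive functor $\mathbb M$ from the category of left $R$-modules to the category of abelian groups; morphisms are natural transformations, and kernels, quotients and direct limits (colimits over non-empty upward directed sets) are taken in the functor category, i.e. objectwise. $\mathbb M$ preserves direct limits if $\varinjlim_i\mathbb M(S_i)\to\mathbb M(\varinjlim_i S_i)$ is an isomorphism for every direct system $\{S_i\}$ of $R$-modules; it preserves direct products if the natural morphism $\mathbb M(\prod_i S_i)\to\prod_i\mathbb M(S_i)$ is an isomorphism for every set $\{S_i\}$ of $R$-modules. An $\mathcal R$-module is an FP module if it preserves direct limits and direct products; it is an ML module if it preserves direct limits and $\mathbb M(\prod_i S_i)\to\prod_i\mathbb M(S_i)$ is injective for every set $\{S_i\}$ of $R$-modules. For an $R$-module $N$ let $\mathcal N$ be the functor $T\mapsto T\otimes_R N$ from right $R$-modules to abelian groups; the module scheme $\mathcal N^*$ of $N$ is the $\mathcal R$-module $S\mapsto \mathrm{Hom}(\mathcal N,\mathcal S)$ (natural transformations, where $\mathcal S(T)=T\otimes_R S$). Theorem. (a) An $\mathcal R$-module $\mathbb M$ is an ML module if and only if $\mathbb M$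 is a direct limit of FP submodules, that is, $\mathbb M=\varinjlim_{i}\mathbb F_i$ for a direct system of FP modules $\mathbb F_i$ whose canonical morphisms $\mathbb F_i\to\mathbb M$ are monomorphisms. (b) Let $\mathbb M$ be an $\mathcal R$-module that preserves direct limits. The following statements are equivalent: 1. $\mathbb M$ is an ML module. 2. $\mathbb M$ is a direct limit of FP submodules. 3. For every FP module $\mathbb F$, the kernel of every morphism $\mathbb F\to\mathbb M$ is an FP module. 4. For every $R$-module $N$, the kernel of every morphism $\mathcal N^*\to\mathbb M$ is isomorphic to a quotient of a module scheme. 5. For every $R$-module $N$, the kernel of every morphism $\mathcal N^*\to\mathbb M$ preserves direct products. -/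

import Mathlib

open CategoryTheory CategoryTheory.Limits
open scoped TensorProduct

universe u

namespace RMod

noncomputable section

/-! Here `R` is an associative ring with unit; `ModuleCat R` is the category of left `R`-modules and
`ModuleCat Rᵐᵒᵖ` the category of right `R`-modules. An `𝓡`-module is an additive functor
`ModuleCat R ⥤ AddCommGrpCat`, a right `𝓡`-module is an additive functor
`ModuleCat Rᵐᵒᵖ ⥤ AddCommGrpCat`. -/

variable {R : Type u} [Ring R]

section TensorProduct

/-- The subgroup of `T ⊗[ℤ] N` generated by the elements `t r ⊗ n - t ⊗ r n`. -/
def balancing (T : Type u) [AddCommGroup T] [Module Rᵐᵒᵖ T] (N : Type u) [AddCommGroup N]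
    [Module R N] : AddSubgroup (T ⊗[ℤ] N) :=
  AddSubgroup.closure
    {x | ∃ (t : T) (r : R) (n : N), x = (MulOpposite.op r • t) ⊗ₜ[ℤ] n - t ⊗ₜ[ℤ] (r • n)}

/-- The tensor product `T ⊗_R N` of a right module `T` and a left module `N` over a ring `R` that
need not be commutative. -/
abbrev BalTensor (R : Type u) [Ring R] (T : Type u) [AddCommGroup T] [Module Rᵐᵒᵖ T]
    (N : Type u) [AddCommGroup N] [Module R N] : Type u :=
  (T ⊗[ℤ] N) ⧸ balancing (R := R) T N

/-- The element `t ⊗ n` of `T ⊗_R N`. -/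
def btmul (R : Type u) [Ring R] {T : Type u} [AddCommGroup T] [Module Rᵐᵒᵖ T]
    {N : Type u} [AddCommGroup N] [Module R N] (t : T) (n : N) : BalTensor R T N :=
  QuotientAddGroup.mk (t ⊗ₜ[ℤ] n)

/-- The homomorphism `f ⊗ g : T ⊗_R N → T' ⊗_R N'`. -/
def BalTensor.map {T T' : Type u} [AddCommGroup T] [Module Rᵐᵒᵖ T] [AddCommGroup T']
    [Module Rᵐᵒᵖ T'] {N N' : Type u} [AddCommGroup N] [Module R N] [AddCommGroup N'] [Module R N']
    (f : T →ₗ[Rᵐᵒᵖ] T') (g : N →ₗ[R] N') : BalTensor R T N →+ BalTensor R T' N' :=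
  QuotientAddGroup.map _ _
    (TensorProduct.map f.toAddMonoidHom.toIntLinearMap g.toAddMonoidHom.toIntLinearMap).toAddMonoidHom
    (by
      rw [balancing, AddSubgroup.closure_le]
      rintro _ ⟨t, r, n, rfl⟩
      refine AddSubgroup.subset_closure ⟨f t, r, g n, ?_⟩
      simp)

@[simp]
theorem BalTensor.map_btmul {T T' : Type u} [AddCommGroup T] [Module Rᵐᵒᵖ T] [AddCommGroup T']
    [Module Rᵐᵒᵖ T'] {N N' : Type u} [AddCommGroup N] [Module R N] [AddCommGroup N'] [Module R N']
    (f : T →ₗ[Rᵐᵒᵖ] T') (g : N →ₗ[R] N') (t : T) (n : N) :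
    BalTensor.map f g (btmul R t n) = btmul R (f t) (g n) := rfl

theorem BalTensor.hom_ext {T : Type u} [AddCommGroup T] [Module Rᵐᵒᵖ T]
    {N : Type u} [AddCommGroup N] [Module R N] {A : Type u} [AddCommGroup A]
    {f g : BalTensor R T N →+ A} (h : ∀ t n, f (btmul R t n) = g (btmul R t n)) : f = g := by
  refine AddMonoidHom.ext fun x => ?_
  obtain ⟨x, rfl⟩ := QuotientAddGroup.mk_surjective x
  induction x with
  | zero => simp
  | tmul t n => exact h t n
  | add x y hx hy => rw [QuotientAddGroup.mk_add, map_add, map_add, hx, hy]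

end TensorProduct

/-- The quasi-coherent right `𝓡`-module `T ↦ T ⊗_R N` of a left `R`-module `N`, as a functor in
`N`. -/
def quasiCoherent (R : Type u) [Ring R] :
    ModuleCat.{u} R ⥤ (ModuleCat.{u} Rᵐᵒᵖ ⥤ AddCommGrpCat.{u}) where
  obj N :=
    { obj := fun T => AddCommGrpCat.of (BalTensor R T N)
      map := fun f => AddCommGrpCat.ofHom (BalTensor.map f.hom LinearMap.id)
      map_id := fun T => AddCommGrpCat.hom_ext (BalTensor.hom_ext fun t n => rfl)
      map_comp := fun f g => AddCommGrpCat.hom_ext (BalTensor.hom_ext fun t n => rfl) }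
  map g :=
    { app := fun T => AddCommGrpCat.ofHom (BalTensor.map LinearMap.id g.hom)
      naturality := fun T T' f => AddCommGrpCat.hom_ext (BalTensor.hom_ext fun t n => rfl) }
  map_id N := by
    ext T : 2
    exact AddCommGrpCat.hom_ext (BalTensor.hom_ext fun t n => rfl)
  map_comp f g := by
    ext T : 2
    exact AddCommGrpCat.hom_ext (BalTensor.hom_ext fun t n => rfl)

/-- The morphisms between two quasi-coherent modules form a small set: such a morphism `α` is
determined by the elements `α (1 ⊗ n)`. -/
instance small_hom_quasiCoherent (N S : ModuleCat.{u} R) :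
    Small.{u} ((quasiCoherent R).obj N ⟶ (quasiCoherent R).obj S) := by
  let Q : ModuleCat.{u} Rᵐᵒᵖ := ModuleCat.of Rᵐᵒᵖ Rᵐᵒᵖ
  refine small_of_injective (β := N → BalTensor R Q S)
    (f := fun α n => (α.app Q).hom (btmul R (1 : Rᵐᵒᵖ) n)) ?_
  intro α β h
  ext T : 2
  refine AddCommGrpCat.hom_ext (BalTensor.hom_ext fun t n => ?_)
  have key : ∀ γ : (quasiCoherent R).obj N ⟶ (quasiCoherent R).obj S,
      (γ.app T).hom (btmul R t n) =
        (((quasiCoherent R).obj S).map (ModuleCat.ofHom (LinearMap.toSpanSingleton Rᵐᵒᵖ T t))).hom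
          ((γ.app Q).hom (btmul R (1 : Rᵐᵒᵖ) n)) := by
    intro γ
    have h1 := congrArg (fun k => k.hom (btmul R (1 : Rᵐᵒᵖ) n))
      (γ.naturality (X := Q) (ModuleCat.ofHom (LinearMap.toSpanSingleton Rᵐᵒᵖ T t)))
    refine Eq.trans ?_ h1
    change _ = (γ.app T).hom (btmul R ((1 : Rᵐᵒᵖ) • t) n)
    rw [one_smul]
  exact (key α).trans ((congrArg _ (congrFun h n)).trans (key β).symm)

/-- The `𝓡`-module scheme `𝓝^*` of an `R`-module `N`: the dual `S ↦ Hom_𝓡(𝓝, 𝓢)` of the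
quasi-coherent module `𝓝` of `N`. -/
def moduleScheme (N : ModuleCat.{u} R) : ModuleCat.{u} R ⥤ AddCommGrpCat.{u} where
  obj S := AddCommGrpCat.of (Shrink.{u} ((quasiCoherent R).obj N ⟶ (quasiCoherent R).obj S))
  map φ := AddCommGrpCat.ofHom
    (AddMonoidHom.mk' (fun x => equivShrink _ ((equivShrink _).symm x ≫ (quasiCoherent R).map φ))
      (fun x y => by simp [Preadditive.add_comp]))
  map_id S := by
    ext x
    simp
  map_comp f g := by
    ext x
    simp

/-- `M` preserves direct limits, that is, colimits of systems indexed by upward directed sets. -/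
def PreservesDirectLimits (M : ModuleCat.{u} R ⥤ AddCommGrpCat.{u}) : Prop :=
  ∀ (I : Type u) [Preorder I] [IsDirectedOrder I] [Nonempty I], PreservesColimitsOfShape I M

/-- The natural morphism `M (∏ i, S i) → ∏ i, M (S i)`. -/
def prodComparison (M : ModuleCat.{u} R ⥤ AddCommGrpCat.{u}) {I : Type u}
    (S : I → ModuleCat.{u} R) : M.obj (ModuleCat.of R (∀ i, S i)) →+ ∀ i, M.obj (S i) :=
  AddMonoidHom.mk' (fun x i => (M.map (ModuleCat.ofHom (LinearMap.proj i))).hom x)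
    (fun x y => by ext i; simp)

/-- `M` preserves direct products. -/
def PreservesDirectProducts (M : ModuleCat.{u} R ⥤ AddCommGrpCat.{u}) : Prop :=
  ∀ (I : Type u) (S : I → ModuleCat.{u} R), Function.Bijective (prodComparison M S)

/-- FP modules: `𝓡`-modules that preserve direct limits and direct products. -/
structure IsFP (M : ModuleCat.{u} R ⥤ AddCommGrpCat.{u}) : Prop where
  additive : M.Additive
  directLimits : PreservesDirectLimits M
  directProducts : PreservesDirectProducts M

/-- ML modules: `𝓡`-modules `M` that preserve direct limits and for which the natural morphism
`M (∏ i, S i) → ∏ i, M (S i)` is injective for every set `{S i}` of `R`-modules. -/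
structure IsML (M : ModuleCat.{u} R ⥤ AddCommGrpCat.{u}) : Prop where
  additive : M.Additive
  directLimits : PreservesDirectLimits M
  injective : ∀ (I : Type u) (S : I → ModuleCat.{u} R), Function.Injective (prodComparison M S)

/-- `M` is the direct limit of a direct system, indexed by an upward directed set, of submodules
of `M` that are FP modules. -/
def IsDirectLimitOfFPSubmodules (M : ModuleCat.{u} R ⥤ AddCommGrpCat.{u}) : Prop :=
  ∃ (I : Type u) (_ : Preorder I) (_ : IsDirectedOrder I) (_ : Nonempty I)
    (F : I ⥤ (ModuleCat.{u} R ⥤ AddCommGrpCat.{u})) (ι : F ⟶ (Functor.const I).obj M),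
    (∀ i, IsFP (F.obj i)) ∧ (∀ i, Mono (ι.app i)) ∧ Nonempty (IsColimit (Cocone.mk M ι))

/-- `K` is isomorphic to a quotient of a module scheme. -/
def IsQuotientOfModuleScheme (K : ModuleCat.{u} R ⥤ AddCommGrpCat.{u}) : Prop :=
  ∃ (N : ModuleCat.{u} R) (p : moduleScheme N ⟶ K), Epi p

end

end RMod

/-!
A natural transformation `T ⊗_R N → T ⊗_R S` is induced by a linear map `N → S`, so the module
scheme `𝓝^*` is the functor `Hom_R(N, -)` (`schemeEquiv`), and by Yoneda's lemma a morphism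
`𝓝^* → M` is an element `x ∈ M(N)`. Its kernel consists of the maps `φ : N → S` that kill `x`, that
is, `M(φ)(x) = 0`. Everything is then a statement about elements, since direct limits of abelian
groups and of modules are described by elements (`IsElementwiseColimit`).

* If `M` is an ML module, then a map `N → ∏ Sᵢ` kills `x` as soon as its components do. So kernels of
  morphisms from a product-preserving functor to `M` preserve products
  (`IsML.preservesDirectProducts_kernel`), and kernels of morphisms from FP modules are FP modules
  (`IsML.isFP_kernel`).
* Conversely, if `M` preserves direct limits, an element of `M(∏ Sᵢ)` comes from an element of `M(P)`
  with `P` finitely presented (`exists_finitelyPresented_rep`). Because `𝓟^*` is an FP module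
  (`isFP_moduleScheme`), it is enough to know that kernels of morphisms `𝓟^* → M` preserve products
  (`isML_of_preservesDirectProducts_kernel`).
* The maps out of `N` that kill `x` have a solution set, as `M` preserves the direct limit of the
  submodules of `S` that contain the image of `N` and are finitely generated over it
  (`exists_factorization_of_map_eq_zero`). When `M` is an ML module, the product of a solution set
  again kills `x`, and it presents the kernel as a quotient of a module scheme
  (`IsML.isQuotientOfModuleScheme_kernel`). Quotients of module schemes that lie in a module scheme
  preserve products.
* Any `M` that preserves direct limits is the directed union of its subfunctors generated by elements
  `x ∈ M(P)` with `P` finitely presented; when `M` is an ML module these are FP modules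
  (`IsML.isFP_generated`). In the other direction, a direct limit of FP submodules inherits the
  preservation of direct limits and the injectivity on products elementwise
  (`IsDirectLimitOfFPSubmodules.isML`).
-/

namespace RMod

noncomputable section

variable {R : Type u} [Ring R]

/-! ### Directed colimits in terms of elements -/

section DirectedColimits

variable {I : Type u} [Preorder I]

/-- A cocone of abelian groups on a directed system is a direct limit exactly when it satisfies this
elementwise condition: every element comes from some stage, and an element of some stage that
vanishes in the limit vanishes at a later stage. -/
structure IsElementwiseColimit {F : I ⥤ AddCommGrpCat.{u}} (c : Cocone F) : Prop where
  exists_rep : ∀ x : c.pt, ∃ i, ∃ y : F.obj i, (c.ι.app i).hom y = x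
  exists_map_eq_zero : ∀ i, ∀ y : F.obj i, (c.ι.app i).hom y = 0 →
    ∃ j, ∃ h : i ≤ j, (F.map (homOfLE h)).hom y = 0

variable [IsDirectedOrder I] [Nonempty I]

theorem nonempty_isColimit_iff {F : I ⥤ AddCommGrpCat.{u}} (c : Cocone F) :
    Nonempty (IsColimit c) ↔ IsElementwiseColimit c := by
  constructor
  · rintro ⟨hc⟩
    refine ⟨fun x => Concrete.isColimit_exists_rep F hc x, fun i y hy => ?_⟩
    obtain ⟨j, f, hf⟩ := (IsColimit.eq_iff' hc y 0).1 (hy.trans (map_zero (c.ι.app i).hom).symm)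
    exact ⟨j, leOfHom f, hf.trans (map_zero (F.map f).hom)⟩
  · intro h
    have : ReflectsColimitsOfShape I (forget AddCommGrpCat.{u}) :=
      reflectsColimitsOfShape_of_reflectsIsomorphisms
    refine ⟨isColimitOfReflects (forget AddCommGrpCat.{u})
      (Types.FilteredColimit.isColimitOf' _ _ (fun x => ?_) (fun i x y hxy => ?_))⟩
    · obtain ⟨i, y, hy⟩ := h.exists_rep x
      exact ⟨i, y, hy.symm⟩
    · obtain ⟨j, hij, hj⟩ := h.exists_map_eq_zero i ((show F.obj i from x) - (show F.obj i from y))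
        ((map_sub _ _ _).trans (sub_eq_zero.2 hxy))
      exact ⟨j, homOfLE hij, sub_eq_zero.1 ((map_sub (F.map (homOfLE hij)).hom _ _).symm.trans hj)⟩

theorem nonempty_isColimit_module_iff {F : I ⥤ ModuleCat.{u} R} (c : Cocone F) :
    Nonempty (IsColimit c) ↔
      IsElementwiseColimit ((forget₂ (ModuleCat.{u} R) AddCommGrpCat.{u}).mapCocone c) := by
  rw [← nonempty_isColimit_iff]
  constructor
  · rintro ⟨hc⟩
    exact ⟨isColimitOfPreserves _ hc⟩
  · rintro ⟨hc⟩
    have : ReflectsColimitsOfShape I (forget₂ (ModuleCat.{u} R) AddCommGrpCat.{u}) :=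
      reflectsColimitsOfShape_of_reflectsIsomorphisms
    exact ⟨isColimitOfReflects (forget₂ (ModuleCat.{u} R) AddCommGrpCat.{u}) hc⟩

end DirectedColimits

theorem preservesDirectLimits_iff (M : ModuleCat.{u} R ⥤ AddCommGrpCat.{u}) :
    PreservesDirectLimits M ↔ ∀ (I : Type u) [Preorder I] [IsDirectedOrder I] [Nonempty I]
      (F : I ⥤ ModuleCat.{u} R) (c : Cocone F), IsColimit c →
        IsElementwiseColimit (M.mapCocone c) := by
  constructor
  · intro h I _ _ _ F c hc
    have := h I
    exact (nonempty_isColimit_iff _).1 ⟨isColimitOfPreserves M hc⟩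
  · intro h I _ _ _
    exact ⟨⟨fun hc => (nonempty_isColimit_iff _).2 (h I _ _ hc)⟩⟩

/-! ### Subfunctors of a functor that preserves direct limits -/

theorem additive_of_injective {K M : ModuleCat.{u} R ⥤ AddCommGrpCat.{u}} [M.Additive] (ι : K ⟶ M)
    (hι : ∀ S, Function.Injective (ι.app S).hom) : K.Additive where
  map_add {S T f g} := by
    ext x
    refine hι T ?_
    have h (k : S ⟶ T) : (ι.app T).hom ((K.map k).hom x) = (M.map k).hom ((ι.app S).hom x) :=
      congrArg (fun k => k.hom x) (ι.naturality k)
    simp [h, map_add, M.map_add]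

/-- Naturality on elements. -/
theorem app_map {K M : ModuleCat.{u} R ⥤ AddCommGrpCat.{u}} (ι : K ⟶ M) {S T : ModuleCat.{u} R}
    (f : S ⟶ T) (x : K.obj S) :
    (ι.app T).hom ((K.map f).hom x) = (M.map f).hom ((ι.app S).hom x) :=
  congrArg (fun k => k.hom x) (ι.naturality f)

theorem map_comp_apply (M : ModuleCat.{u} R ⥤ AddCommGrpCat.{u}) {S T U : ModuleCat.{u} R}
    (f : S ⟶ T) (g : T ⟶ U) (x : M.obj S) :
    (M.map (f ≫ g)).hom x = (M.map g).hom ((M.map f).hom x) := by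
  simp

theorem map_id_apply (M : ModuleCat.{u} R ⥤ AddCommGrpCat.{u}) {S : ModuleCat.{u} R}
    (x : M.obj S) : (M.map (𝟙 S)).hom x = x := by
  simp

theorem prodComparison_apply (M : ModuleCat.{u} R ⥤ AddCommGrpCat.{u}) {I : Type u}
    (S : I → ModuleCat.{u} R) (x : M.obj (ModuleCat.of R (∀ i, S i))) (i : I) :
    prodComparison M S x i =
      (M.map (ModuleCat.ofHom (LinearMap.proj i) : ModuleCat.of R (∀ i, S i) ⟶ S i)).hom x := rfl

/-- A subfunctor of a functor preserving direct limits preserves direct limits as soon as its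
elements come from finite stages. -/
theorem preservesDirectLimits_of_injective {K M : ModuleCat.{u} R ⥤ AddCommGrpCat.{u}}
    (hM : PreservesDirectLimits M) (ι : K ⟶ M) (hι : ∀ S, Function.Injective (ι.app S).hom)
    (h : ∀ (I : Type u) [Preorder I] [IsDirectedOrder I] [Nonempty I] (F : I ⥤ ModuleCat.{u} R)
      (c : Cocone F), IsColimit c → ∀ x : K.obj c.pt,
        ∃ i, ∃ y : K.obj (F.obj i), (K.map (c.ι.app i)).hom y = x) :
    PreservesDirectLimits K := by
  rw [preservesDirectLimits_iff] at hM ⊢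
  intro I _ _ _ F c hc
  refine ⟨h I F c hc, fun i y hy => ?_⟩
  obtain ⟨j, hij, hj⟩ := (hM I F c hc).exists_map_eq_zero i ((ι.app _).hom y) (by
    refine (app_map ι (c.ι.app i) y).symm.trans ?_
    rw [show (K.map (c.ι.app i)).hom y = 0 from hy, map_zero])
  refine ⟨j, hij, hι _ ?_⟩
  rw [map_zero]
  exact (app_map ι (F.map (homOfLE hij)) y).trans hj

theorem prodComparison_injective_of_injective {K M : ModuleCat.{u} R ⥤ AddCommGrpCat.{u}}
    (ι : K ⟶ M) (hι : ∀ S, Function.Injective (ι.app S).hom) {I : Type u}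
    {S : I → ModuleCat.{u} R} (h : Function.Injective (prodComparison M S)) :
    Function.Injective (prodComparison K S) := by
  rw [injective_iff_map_eq_zero] at h ⊢
  intro x hx
  refine hι _ ((h _ (funext fun i => ?_)).trans (map_zero _).symm)
  refine (app_map ι _ x).symm.trans ?_
  rw [show (K.map _).hom x = 0 from congrFun hx i, map_zero]
  rfl

theorem injective_app_of_mono {K M : ModuleCat.{u} R ⥤ AddCommGrpCat.{u}} (ι : K ⟶ M) [Mono ι]
    (S : ModuleCat.{u} R) : Function.Injective (ι.app S).hom :=
  (AddCommGrpCat.mono_iff_injective (ι.app S)).1 inferInstance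

theorem kernel_condition_app {F M : ModuleCat.{u} R ⥤ AddCommGrpCat.{u}} (f : F ⟶ M)
    {S : ModuleCat.{u} R} (x : ((kernel f : ModuleCat.{u} R ⥤ AddCommGrpCat.{u})).obj S) :
    (f.app S).hom (((kernel.ι f).app S).hom x) = 0 :=
  congrArg (fun k : kernel f ⟶ M => (k.app S).hom x) (kernel.condition f)

theorem exists_kernel_ι_eq {F M : ModuleCat.{u} R ⥤ AddCommGrpCat.{u}} (f : F ⟶ M)
    {S : ModuleCat.{u} R} (z : F.obj S) (hz : (f.app S).hom z = 0) :
    ∃ x, ((kernel.ι f).app S).hom x = z := by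
  have hl := isLimitForkMapOfIsLimit' ((evaluation _ AddCommGrpCat.{u}).obj S)
    (kernel.condition f) (kernelIsKernel f)
  have hk : IsLimit (KernelFork.ofι ((kernel.ι f).app S)
    (congrArg (fun k : kernel f ⟶ M => k.app S) (kernel.condition f))) := hl
  let e := hk.conePointUniqueUpToIso (AddCommGrpCat.kernelIsLimit (f.app S))
  refine ⟨e.inv.hom ⟨z, hz⟩, ?_⟩
  exact congrArg (fun k => k.hom ⟨z, hz⟩)
    (hk.conePointUniqueUpToIso_inv_comp (AddCommGrpCat.kernelIsLimit (f.app S)) .zero)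

/-! ### Module schemes are corepresentable -/

section ModuleScheme

theorem btmul_add_right {T N : Type u} [AddCommGroup T] [Module Rᵐᵒᵖ T] [AddCommGroup N]
    [Module R N] (t : T) (n n' : N) : btmul R t (n + n') = btmul R t n + btmul R t n' :=
  congrArg QuotientAddGroup.mk (TensorProduct.tmul_add t n n')

theorem btmul_smul {T N : Type u} [AddCommGroup T] [Module Rᵐᵒᵖ T] [AddCommGroup N]
    [Module R N] (t : T) (r : R) (n : N) :
    btmul R t (r • n) = btmul R (MulOpposite.op r • t) n := by
  refine (QuotientAddGroup.eq_iff_sub_mem.2 ?_).symm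
  exact AddSubgroup.subset_closure ⟨t, r, n, rfl⟩

/-- The canonical homomorphism `R ⊗_R N → N`, `r ⊗ n ↦ r n`; the right module `R` is encoded as
`Rᵐᵒᵖ` acting on itself from the left. -/
def tensorUnit (R : Type u) [Ring R] (N : Type u) [AddCommGroup N] [Module R N] :
    BalTensor R Rᵐᵒᵖ N →+ N :=
  QuotientAddGroup.lift _ (TensorProduct.lift (LinearMap.mk₂ ℤ
    (fun (t : Rᵐᵒᵖ) (n : N) => t.unop • n) (fun t t' n => add_smul _ _ _)
    (fun k t n => by rw [MulOpposite.unop_smul, smul_assoc]) (fun t n n' => smul_add _ _ _)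
    (fun k t n => smul_comm _ _ _))).toAddMonoidHom (by
      rw [balancing, AddSubgroup.closure_le]
      rintro _ ⟨t, r, n, rfl⟩
      simp [mul_smul])

@[simp]
theorem tensorUnit_btmul {N : Type u} [AddCommGroup N] [Module R N] (t : Rᵐᵒᵖ) (n : N) :
    tensorUnit R N (btmul R t n) = t.unop • n := rfl

theorem btmul_one_tensorUnit {N : Type u} [AddCommGroup N] [Module R N]
    (z : BalTensor R Rᵐᵒᵖ N) : btmul R (1 : Rᵐᵒᵖ) (tensorUnit R N z) = z := by
  let f : BalTensor R Rᵐᵒᵖ N →+ BalTensor R Rᵐᵒᵖ N :=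
    AddMonoidHom.mk' (fun z => btmul R (1 : Rᵐᵒᵖ) (tensorUnit R N z))
      (fun x y => by rw [map_add, btmul_add_right])
  refine DFunLike.congr_fun (f := f) (g := AddMonoidHom.id _) (BalTensor.hom_ext fun t n => ?_) z
  change btmul R (1 : Rᵐᵒᵖ) (t.unop • n) = btmul R t n
  rw [btmul_smul]
  simp

/-- By naturality along `R → T`, `1 ↦ t`, a morphism of quasi-coherent modules is determined by its
values on the elements `1 ⊗ n`. -/
theorem quasiCoherent_app_btmul {N S : ModuleCat.{u} R}
    (γ : (quasiCoherent R).obj N ⟶ (quasiCoherent R).obj S) (T : ModuleCat.{u} Rᵐᵒᵖ) (t : T)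
    (n : N) :
    (γ.app T).hom (btmul R t n) =
      BalTensor.map (LinearMap.toSpanSingleton Rᵐᵒᵖ T t) LinearMap.id
        ((γ.app (ModuleCat.of Rᵐᵒᵖ Rᵐᵒᵖ)).hom (btmul R (1 : Rᵐᵒᵖ) n)) := by
  have h1 := congrArg (fun k => k.hom (btmul R (1 : Rᵐᵒᵖ) n))
    (γ.naturality (X := ModuleCat.of Rᵐᵒᵖ Rᵐᵒᵖ)
      (ModuleCat.ofHom (LinearMap.toSpanSingleton Rᵐᵒᵖ T t)))
  refine Eq.trans ?_ h1
  change _ = (γ.app T).hom (btmul R ((1 : Rᵐᵒᵖ) • t) n)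
  rw [one_smul]

theorem tensorUnit_map_toSpanSingleton {S : Type u} [AddCommGroup S] [Module R S] (r : R)
    (z : BalTensor R Rᵐᵒᵖ S) :
    tensorUnit R S (BalTensor.map (LinearMap.toSpanSingleton Rᵐᵒᵖ Rᵐᵒᵖ (MulOpposite.op r))
      LinearMap.id z) = r • tensorUnit R S z := by
  refine DFunLike.congr_fun
    (f := (tensorUnit R S).comp (BalTensor.map (LinearMap.toSpanSingleton Rᵐᵒᵖ Rᵐᵒᵖ
      (MulOpposite.op r)) LinearMap.id))
    (g := (DistribSMul.toAddMonoidHom S r).comp (tensorUnit R S))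
    (BalTensor.hom_ext fun t s => ?_) z
  simp [mul_smul]

/-- A morphism of quasi-coherent modules `𝓝 → 𝓢` is induced by the linear map
`N = R ⊗_R N → R ⊗_R S = S`. -/
theorem quasiCoherent_map_bijective (N S : ModuleCat.{u} R) :
    Function.Bijective (fun φ : N ⟶ S => (quasiCoherent R).map φ) := by
  constructor
  · intro φ ψ h
    ext n
    have h1 := congrArg (fun γ : (quasiCoherent R).obj N ⟶ (quasiCoherent R).obj S =>
      tensorUnit R S ((γ.app (ModuleCat.of Rᵐᵒᵖ Rᵐᵒᵖ)).hom (btmul R (1 : Rᵐᵒᵖ) n))) h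
    have h2 : (1 : R) • φ.hom n = (1 : R) • ψ.hom n := h1
    simpa using h2
  · intro γ
    let Q := ModuleCat.of Rᵐᵒᵖ Rᵐᵒᵖ
    let φ : N →ₗ[R] S :=
      { toFun := fun n => tensorUnit R S ((γ.app Q).hom (btmul R (1 : Rᵐᵒᵖ) n))
        map_add' := fun n n' => by
          rw [btmul_add_right]
          exact (congrArg _ (map_add (γ.app Q).hom _ _)).trans (map_add _ _ _)
        map_smul' := fun r n => by
          rw [btmul_smul, smul_eq_mul, mul_one]
          exact (congrArg _ (quasiCoherent_app_btmul γ Q (MulOpposite.op r) n)).trans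
            (tensorUnit_map_toSpanSingleton r _) }
    refine ⟨ModuleCat.ofHom φ, ?_⟩
    ext T : 2
    refine AddCommGrpCat.hom_ext (BalTensor.hom_ext fun t n => ?_)
    refine Eq.trans ?_ (quasiCoherent_app_btmul γ T t n).symm
    refine Eq.trans ?_ (congrArg (BalTensor.map (LinearMap.toSpanSingleton Rᵐᵒᵖ T t) LinearMap.id)
      (btmul_one_tensorUnit ((γ.app Q).hom (btmul R (1 : Rᵐᵒᵖ) n))))
    change btmul R t (φ n) = btmul R ((1 : Rᵐᵒᵖ) • t) (φ n)
    rw [one_smul]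

theorem quasiCoherent_map_add {N S : ModuleCat.{u} R} (φ ψ : N ⟶ S) :
    (quasiCoherent R).map (φ + ψ) = (quasiCoherent R).map φ + (quasiCoherent R).map ψ := by
  ext T : 2
  exact AddCommGrpCat.hom_ext (BalTensor.hom_ext fun t n => btmul_add_right t (φ.hom n) (ψ.hom n))

/-- The module scheme of `N` is corepresented by `N`: the identification
`Hom_R(N, S) = 𝓝^*(S)`. -/
def schemeEquiv (N S : ModuleCat.{u} R) : (N ⟶ S) ≃+ (moduleScheme N).obj S :=
  AddEquiv.mk' ((Equiv.ofBijective _ (quasiCoherent_map_bijective N S)).trans (equivShrink _))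
    (fun φ ψ => by
      change equivShrink _ ((quasiCoherent R).map (φ + ψ)) = equivShrink _ _ + equivShrink _ _
      rw [quasiCoherent_map_add, equivShrink_add]
      rfl)

theorem moduleScheme_map_schemeEquiv {N S T : ModuleCat.{u} R} (φ : N ⟶ S) (ψ : S ⟶ T) :
    ((moduleScheme N).map ψ).hom (schemeEquiv N S φ) = schemeEquiv N T (φ ≫ ψ) := by
  change equivShrink _ ((equivShrink _).symm (equivShrink _ ((quasiCoherent R).map φ)) ≫
    (quasiCoherent R).map ψ) = equivShrink _ ((quasiCoherent R).map (φ ≫ ψ))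
  rw [Equiv.symm_apply_apply, Functor.map_comp]

instance (N : ModuleCat.{u} R) : (moduleScheme N).Additive where
  map_add {S T f g} := by
    ext x
    obtain ⟨φ, rfl⟩ := (schemeEquiv N S).surjective x
    rw [moduleScheme_map_schemeEquiv, Preadditive.comp_add, map_add]
    exact congrArg₂ (· + ·) (moduleScheme_map_schemeEquiv φ f).symm
      (moduleScheme_map_schemeEquiv φ g).symm

/-- Yoneda's lemma: a morphism out of `𝓝^*` is determined by the image of the identity of `N`. -/
theorem app_schemeEquiv {N : ModuleCat.{u} R} {M : ModuleCat.{u} R ⥤ AddCommGrpCat.{u}}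
    (f : moduleScheme N ⟶ M) {S : ModuleCat.{u} R} (φ : N ⟶ S) :
    (f.app S).hom (schemeEquiv N S φ) =
      (M.map φ).hom ((f.app N).hom (schemeEquiv N N (𝟙 N))) := by
  rw [← app_map, moduleScheme_map_schemeEquiv, Category.id_comp]

/-- The homomorphism `Hom_R(N, S) → M(S)`, `φ ↦ M(φ)(x)`, attached to `x ∈ M(N)`. -/
def evalHom (M : ModuleCat.{u} R ⥤ AddCommGrpCat.{u}) [M.Additive] {N : ModuleCat.{u} R}
    (x : M.obj N) (S : ModuleCat.{u} R) : (N ⟶ S) →+ M.obj S :=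
  AddMonoidHom.mk' (fun φ => (M.map φ).hom x) (fun φ ψ => by simp [M.map_add])

/-- The morphism `𝓝^* → M` that corresponds to `x ∈ M(N)` under Yoneda's lemma. -/
def schemeHom (M : ModuleCat.{u} R ⥤ AddCommGrpCat.{u}) [M.Additive] {N : ModuleCat.{u} R}
    (x : M.obj N) : moduleScheme N ⟶ M where
  app S := AddCommGrpCat.ofHom ((evalHom M x S).comp (schemeEquiv N S).symm.toAddMonoidHom)
  naturality S T ψ := by
    ext y
    obtain ⟨φ, rfl⟩ := (schemeEquiv N S).surjective y
    have h : (evalHom M x T) ((schemeEquiv N T).symm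
        (((moduleScheme N).map ψ).hom (schemeEquiv N S φ))) =
        (M.map ψ).hom (evalHom M x S ((schemeEquiv N S).symm (schemeEquiv N S φ))) := by
      rw [moduleScheme_map_schemeEquiv, AddEquiv.symm_apply_apply, AddEquiv.symm_apply_apply]
      exact map_comp_apply M φ ψ x
    exact h

theorem schemeHom_app {M : ModuleCat.{u} R ⥤ AddCommGrpCat.{u}} [M.Additive]
    {N : ModuleCat.{u} R} (x : M.obj N) {S : ModuleCat.{u} R} (φ : N ⟶ S) :
    ((schemeHom M x).app S).hom (schemeEquiv N S φ) = (M.map φ).hom x := by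
  change (M.map ((schemeEquiv N S).symm (schemeEquiv N S φ))).hom x = _
  rw [AddEquiv.symm_apply_apply]

/-- The kernel of the morphism `𝓝^* → M` given by `x ∈ M(N)` consists of the maps `φ : N → S` with
`M(φ)(x) = 0`. -/
theorem exists_kernel_ι_eq_schemeEquiv_iff {M : ModuleCat.{u} R ⥤ AddCommGrpCat.{u}}
    {N : ModuleCat.{u} R}
    (f : moduleScheme N ⟶ M) {S : ModuleCat.{u} R} (φ : N ⟶ S) :
    (∃ z, ((kernel.ι f).app S).hom z = schemeEquiv N S φ) ↔
      (M.map φ).hom ((f.app N).hom (schemeEquiv N N (𝟙 N))) = 0 := by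
  rw [← app_schemeEquiv]
  exact ⟨fun ⟨z, hz⟩ => hz ▸ kernel_condition_app f z, exists_kernel_ι_eq f _⟩

theorem preservesDirectProducts_moduleScheme (N : ModuleCat.{u} R) :
    PreservesDirectProducts (moduleScheme N) := by
  intro I S
  constructor
  · intro x y h
    obtain ⟨φ, rfl⟩ := (schemeEquiv N _).surjective x
    obtain ⟨ψ, rfl⟩ := (schemeEquiv N _).surjective y
    congr 1
    ext n i
    have hi : ((moduleScheme N).map (ModuleCat.ofHom (LinearMap.proj i))).hom
        (schemeEquiv N (ModuleCat.of R (∀ i, S i)) φ) =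
        ((moduleScheme N).map (ModuleCat.ofHom (LinearMap.proj i))).hom
        (schemeEquiv N (ModuleCat.of R (∀ i, S i)) ψ) := congrFun h i
    rw [moduleScheme_map_schemeEquiv, moduleScheme_map_schemeEquiv] at hi
    exact congrArg (fun k : N ⟶ S i => k.hom n) ((schemeEquiv N (S i)).injective hi)
  · intro z
    refine ⟨schemeEquiv N _ (ModuleCat.ofHom (LinearMap.pi fun i =>
      ((schemeEquiv N (S i)).symm (z i)).hom)), funext fun i => ?_⟩
    refine (moduleScheme_map_schemeEquiv _ _).trans ?_
    exact (schemeEquiv N (S i)).apply_symm_apply (z i)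

end ModuleScheme

/-! ### Finitely presented modules and direct limits -/

section FinitePresentation

variable {I : Type u} [Preorder I] [IsDirectedOrder I] [Nonempty I]

/-- A map from a finitely generated module that vanishes in a direct limit vanishes at some stage: a
stage at which the images of finitely many generators vanish. -/
theorem exists_comp_map_eq_zero {F : I ⥤ ModuleCat.{u} R} {c : Cocone F} (hc : IsColimit c)
    (P : ModuleCat.{u} R) [Module.Finite R P] {i : I} (φ : P ⟶ F.obj i)
    (h : φ ≫ c.ι.app i = 0) : ∃ j, ∃ hij : i ≤ j, φ ≫ F.map (homOfLE hij) = 0 := by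
  classical
  obtain ⟨s, hs⟩ := Module.Finite.fg_top (R := R) (M := P)
  have hc' := (nonempty_isColimit_module_iff c).1 ⟨hc⟩
  have hp (p : P) : ∃ j, ∃ hij : i ≤ j, (F.map (homOfLE hij)).hom (φ.hom p) = 0 :=
    hc'.exists_map_eq_zero i (φ.hom p) (congrArg (fun k => k.hom p) h)
  choose j hij hj using hp
  obtain ⟨m, hm⟩ := Finset.exists_le (insert i (s.image j))
  have him : i ≤ m := hm i (Finset.mem_insert_self _ _)
  refine ⟨m, him, ModuleCat.hom_ext (LinearMap.ext_on (s := (s : Set P)) hs fun p hp => ?_)⟩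
  have hjm : j p ≤ m := hm _ (Finset.mem_insert_of_mem (Finset.mem_image_of_mem j hp))
  rw [← homOfLE_comp (hij p) hjm, F.map_comp]
  change (F.map (homOfLE hjm)).hom ((F.map (homOfLE (hij p))).hom (φ.hom p)) = 0
  rw [hj, map_zero]

/-- A map from a finitely presented module to a direct limit factors through some stage: the
generators lift to a stage, and the finitely many relations hold at a later one. -/
theorem exists_comp_ι_eq {F : I ⥤ ModuleCat.{u} R} {c : Cocone F} (hc : IsColimit c)
    (P : ModuleCat.{u} R) [Module.FinitePresentation R P] (φ : P ⟶ c.pt) :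
    ∃ i, ∃ ψ : P ⟶ F.obj i, ψ ≫ c.ι.app i = φ := by
  classical
  obtain ⟨n, K, e, hK⟩ := Module.FinitePresentation.exists_fin R P
  have hc' := (nonempty_isColimit_module_iff c).1 ⟨hc⟩
  let φ' : (Fin n → R) →ₗ[R] c.pt := φ.hom ∘ₗ e.symm.toLinearMap ∘ₗ K.mkQ
  have hk (k : Fin n) : ∃ i, ∃ y : F.obj i, (c.ι.app i).hom y = φ' (Pi.basisFun R (Fin n) k) :=
    hc'.exists_rep _
  choose i y hy using hk
  obtain ⟨m, hm⟩ := Finset.exists_le (Finset.univ.image i)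
  have him (k : Fin n) : i k ≤ m := hm _ (Finset.mem_image_of_mem i (Finset.mem_univ k))
  let g : (Fin n → R) →ₗ[R] F.obj m :=
    (Pi.basisFun R (Fin n)).constr ℕ fun k => (F.map (homOfLE (him k))).hom (y k)
  have hg : (c.ι.app m).hom ∘ₗ g = φ' := by
    refine (Pi.basisFun R (Fin n)).ext fun k => ?_
    rw [LinearMap.comp_apply, Module.Basis.constr_basis, ← hy k]
    exact congrArg (fun f => f.hom (y k)) (c.w (homOfLE (him k)))
  have : Module.Finite R K := Module.Finite.iff_fg.2 hK
  obtain ⟨j, hj, hj0⟩ := exists_comp_map_eq_zero hc (ModuleCat.of R K) (i := m)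
    (ModuleCat.ofHom (g ∘ₗ K.subtype)) (by
      ext k
      refine (DFunLike.congr_fun hg (k : Fin n → R)).trans ?_
      have h0 : K.mkQ (k : Fin n → R) = 0 := (Submodule.Quotient.mk_eq_zero K).2 k.2
      change φ.hom (e.symm (K.mkQ k)) = 0
      rw [h0, map_zero, map_zero])
  have hle : K ≤ LinearMap.ker ((F.map (homOfLE hj)).hom ∘ₗ g) := fun k hk =>
    congrArg (fun f : ModuleCat.of R K ⟶ F.obj j => f.hom ⟨k, hk⟩) hj0
  refine ⟨j, ModuleCat.ofHom (K.liftQ _ hle ∘ₗ e.toLinearMap), ?_⟩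
  ext p
  obtain ⟨p, rfl⟩ := e.symm.surjective p
  obtain ⟨p, rfl⟩ := K.mkQ_surjective p
  refine Eq.trans ?_ (DFunLike.congr_fun hg p)
  change (c.ι.app j).hom (K.liftQ _ hle (e (e.symm (K.mkQ p)))) = _
  rw [e.apply_symm_apply]
  exact congrArg (fun f => f.hom (g p)) (c.w (homOfLE hj))

end FinitePresentation

section Approximation

variable {I : Type u} [Preorder I]

/-- The direct system of the members of a monotone family of submodules. -/
def submoduleSystem {S : ModuleCat.{u} R} (V : I →o Submodule R S) : I ⥤ ModuleCat.{u} R where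
  obj i := ModuleCat.of R (V i)
  map f := ModuleCat.ofHom (Submodule.inclusion (V.monotone (leOfHom f)))

/-- The inclusions of a monotone family of submodules. -/
def submoduleCocone {S : ModuleCat.{u} R} (V : I →o Submodule R S) : Cocone (submoduleSystem V) where
  pt := S
  ι := { app := fun i => ModuleCat.ofHom (V i).subtype }

/-- The direct system of the quotients of a module by a monotone family of submodules. -/
def quotientSystem {L : ModuleCat.{u} R} (K : I →o Submodule R L) : I ⥤ ModuleCat.{u} R where
  obj i := ModuleCat.of R (L ⧸ K i)
  map f := ModuleCat.ofHom (Submodule.factor (K.monotone (leOfHom f)))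

/-- The projections onto the image of a map `π` from the quotients by submodules of its kernel. -/
def quotientCocone {L Q : ModuleCat.{u} R} (K : I →o Submodule R L) (π : L →ₗ[R] Q)
    (hK : ∀ i, K i ≤ LinearMap.ker π) : Cocone (quotientSystem K) where
  pt := Q
  ι := { app := fun i => ModuleCat.ofHom ((K i).liftQ π (hK i))
         naturality := fun i j f => by
          ext x
          obtain ⟨x, rfl⟩ := (K i).mkQ_surjective x
          rfl }

variable [IsDirectedOrder I] [Nonempty I]

theorem isElementwiseColimit_submodule {M : ModuleCat.{u} R ⥤ AddCommGrpCat.{u}}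
    (hM : PreservesDirectLimits M) {S : ModuleCat.{u} R} (V : I →o Submodule R S)
    (hV : ∀ s, ∃ i, s ∈ V i) : IsElementwiseColimit (M.mapCocone (submoduleCocone V)) := by
  obtain ⟨hc⟩ := (nonempty_isColimit_module_iff (submoduleCocone V)).2
    ⟨fun s => (hV s).imp fun i hi => ⟨⟨s, hi⟩, rfl⟩,
      fun i y hy => ⟨i, le_rfl, Subtype.ext hy⟩⟩
  exact (preservesDirectLimits_iff M).1 hM I _ _ hc

theorem isElementwiseColimit_quotient {M : ModuleCat.{u} R ⥤ AddCommGrpCat.{u}}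
    (hM : PreservesDirectLimits M) {L Q : ModuleCat.{u} R} (K : I →o Submodule R L)
    (π : L →ₗ[R] Q) (hπ : Function.Surjective π) (hK : ∀ i, K i ≤ LinearMap.ker π)
    (h : ∀ x ∈ LinearMap.ker π, ∃ i, x ∈ K i) :
    IsElementwiseColimit (M.mapCocone (quotientCocone K π hK)) := by
  obtain ⟨hc⟩ := (nonempty_isColimit_module_iff (quotientCocone K π hK)).2 (by
    refine ⟨fun q => ?_, fun i y hy => ?_⟩
    · obtain ⟨x, hx⟩ := hπ q
      exact ⟨Classical.arbitrary I, (K _).mkQ x, hx⟩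
    · obtain ⟨x, rfl⟩ := (K i).mkQ_surjective y
      obtain ⟨j, hj⟩ := h x hy
      obtain ⟨m, him, hjm⟩ := exists_ge_ge i j
      exact ⟨m, him, (Submodule.Quotient.mk_eq_zero (K m)).2 (K.monotone hjm hj)⟩)
  exact (preservesDirectLimits_iff M).1 hM I _ _ hc

end Approximation

/-- Every element of `M(S)` is the image of an element of `M(P)` for some finitely presented `P`,
because `S` is the direct limit of its finitely generated submodules, and a quotient `Rⁿ / K` is the
direct limit of the quotients of `Rⁿ` by the finitely generated submodules of `K`. -/
theorem exists_finitelyPresented_rep {M : ModuleCat.{u} R ⥤ AddCommGrpCat.{u}}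
    (hM : PreservesDirectLimits M) {S : ModuleCat.{u} R} (y : M.obj S) :
    ∃ (n : ℕ) (K : Submodule R (Fin n → R)) (_ : K.FG)
      (φ : ModuleCat.of R ((Fin n → R) ⧸ K) ⟶ S) (x : M.obj (ModuleCat.of R ((Fin n → R) ⧸ K))),
      (M.map φ).hom x = y := by
  classical
  let V : Finset S →o Submodule R S :=
    ⟨fun t => Submodule.span R (t : Set S), fun s t h => Submodule.span_mono h⟩
  obtain ⟨t, z, rfl⟩ := (isElementwiseColimit_submodule hM V
    (fun s => ⟨{s}, Submodule.subset_span (by simp)⟩)).exists_rep y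
  obtain ⟨n, π, hπ⟩ := Module.Finite.exists_fin' R (Submodule.span R (t : Set S))
  let K : Finset (LinearMap.ker π) →o Submodule R (ModuleCat.of R (Fin n → R)) :=
    ⟨fun t => Submodule.span R ((↑) '' (t : Set (LinearMap.ker π))),
      fun s t h => Submodule.span_mono (Set.image_mono h)⟩
  have hK (k) : K k ≤ LinearMap.ker π := Submodule.span_le.2 (by rintro _ ⟨x, -, rfl⟩; exact x.2)
  obtain ⟨k, x, hx⟩ := (isElementwiseColimit_quotient (Q := ModuleCat.of R (V t)) hM K π hπ hK
    (fun x hx => ⟨{⟨x, hx⟩}, Submodule.subset_span (by simp)⟩)).exists_rep z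
  refine ⟨n, K k, Submodule.fg_span (k.finite_toSet.image _),
    ModuleCat.ofHom ((V t).subtype ∘ₗ (K k).liftQ π (hK k)), x,
    (map_comp_apply M (ModuleCat.ofHom ((K k).liftQ π (hK k))) (ModuleCat.ofHom (V t).subtype)
      x).trans ?_⟩
  exact congrArg _ hx

theorem isFP_moduleScheme (P : ModuleCat.{u} R) [Module.FinitePresentation R P] :
    IsFP (moduleScheme P) := by
  refine ⟨inferInstance, ?_, preservesDirectProducts_moduleScheme P⟩
  rw [preservesDirectLimits_iff]
  intro I _ _ _ F c hc
  refine ⟨fun x => ?_, fun i y hy => ?_⟩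
  · obtain ⟨φ, rfl⟩ := (schemeEquiv P _).surjective x
    obtain ⟨i, ψ, rfl⟩ := exists_comp_ι_eq hc P φ
    exact ⟨i, schemeEquiv P _ ψ, moduleScheme_map_schemeEquiv _ _⟩
  · obtain ⟨φ, rfl⟩ := (schemeEquiv P _).surjective y
    have h0 : φ ≫ c.ι.app i = 0 := (map_eq_zero_iff _ (schemeEquiv P _).injective).1
      ((moduleScheme_map_schemeEquiv φ (c.ι.app i)).symm.trans hy)
    obtain ⟨j, hij, hj⟩ := exists_comp_map_eq_zero hc P φ h0
    refine ⟨j, hij, (moduleScheme_map_schemeEquiv φ (F.map (homOfLE hij))).trans ?_⟩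
    rw [hj, map_zero]

/-! ### Kernels of morphisms into ML modules -/

section Kernels

variable {M : ModuleCat.{u} R ⥤ AddCommGrpCat.{u}}

/-- Given `z ∈ F(∏ Sᵢ)` with components in the kernel of `f : F → M`, the element `f(z)` of
`M(∏ Sᵢ)` has vanishing components, hence vanishes. -/
theorem IsML.preservesDirectProducts_kernel (hM : IsML M)
    {F : ModuleCat.{u} R ⥤ AddCommGrpCat.{u}} (hF : PreservesDirectProducts F) (f : F ⟶ M) :
    PreservesDirectProducts (kernel f) := by
  have hι := injective_app_of_mono (kernel.ι f)
  refine fun I S => ⟨prodComparison_injective_of_injective (kernel.ι f) hι (hF I S).1, fun x => ?_⟩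
  obtain ⟨z, hz⟩ := (hF I S).2 fun i => ((kernel.ι f).app (S i)).hom (x i)
  have hz' (i : I) : (F.map (ModuleCat.ofHom (LinearMap.proj i))).hom z =
    ((kernel.ι f).app (S i)).hom (x i) := congrFun hz i
  obtain ⟨w, hw⟩ := exists_kernel_ι_eq f z (hM.injective I S (funext fun i => by
    refine (app_map f (ModuleCat.ofHom (LinearMap.proj i)) z).symm.trans ?_
    rw [hz' i, kernel_condition_app, map_zero]
    rfl))
  refine ⟨w, funext fun i => hι _ ?_⟩
  refine (app_map _ _ w).trans ?_
  rw [hw, hz' i]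

theorem IsML.isFP_kernel (hM : IsML M) {F : ModuleCat.{u} R ⥤ AddCommGrpCat.{u}} (hF : IsFP F)
    (f : F ⟶ M) : IsFP (kernel f) := by
  have := hF.additive
  have hι := injective_app_of_mono (kernel.ι f)
  refine ⟨additive_of_injective (kernel.ι f) hι,
    preservesDirectLimits_of_injective hF.directLimits (kernel.ι f) hι ?_,
    hM.preservesDirectProducts_kernel hF.directProducts f⟩
  intro I _ _ _ D c hc x
  obtain ⟨i, y, hy⟩ := ((preservesDirectLimits_iff F).1 hF.directLimits I D c hc).exists_rep
    (((kernel.ι f).app c.pt).hom x)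
  replace hy : (F.map (c.ι.app i)).hom y = ((kernel.ι f).app c.pt).hom x := hy
  obtain ⟨j, hij, hj⟩ := ((preservesDirectLimits_iff M).1 hM.directLimits I D c
    hc).exists_map_eq_zero i ((f.app _).hom y) (by
      refine (app_map f (c.ι.app i) y).symm.trans ?_
      rw [hy]
      exact kernel_condition_app f x)
  obtain ⟨z, hz⟩ := exists_kernel_ι_eq f ((F.map (D.map (homOfLE hij))).hom y)
    ((app_map f _ y).trans hj)
  refine ⟨j, z, hι _ ?_⟩
  rw [app_map, hz, ← map_comp_apply, c.w]
  exact hy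

/-- If the kernel of the morphism `𝓝^* → M` given by `x ∈ M(N)` preserves products, then `M(φ)(x)`
vanishes for every `φ : N → ∏ Sᵢ` such that its components kill `x`. -/
theorem map_eq_zero_of_preservesDirectProducts_kernel [M.Additive] {N : ModuleCat.{u} R}
    (x : M.obj N) (h : PreservesDirectProducts (kernel (schemeHom M x))) {I : Type u}
    {S : I → ModuleCat.{u} R} (φ : N ⟶ ModuleCat.of R (∀ i, S i))
    (hφ : ∀ i, (M.map (φ ≫ ModuleCat.ofHom (LinearMap.proj i) : N ⟶ S i)).hom x = 0) :
    (M.map φ).hom x = 0 := by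
  have hx {T : ModuleCat.{u} R} (ψ : N ⟶ T) := exists_kernel_ι_eq_schemeEquiv_iff (schemeHom M x) ψ
  simp only [schemeHom_app, map_id_apply] at hx
  choose z hz using fun i => (hx _).2 (hφ i)
  obtain ⟨w, hw⟩ := (h I S).2 z
  refine (hx φ).1 ⟨w, ?_⟩
  refine (preservesDirectProducts_moduleScheme N I S).1 (funext fun i => ?_)
  rw [prodComparison_apply, prodComparison_apply, ← app_map, moduleScheme_map_schemeEquiv, ← hz i,
    ← hw, prodComparison_apply]

/-- It suffices to test the injectivity of `M(∏ Sᵢ) → ∏ M(Sᵢ)` on the elements that come from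
finitely presented modules `P`, and there it follows from the kernels of the morphisms
`𝓟^* → M`. -/
theorem isML_of_preservesDirectProducts_kernel [M.Additive] (hM : PreservesDirectLimits M)
    (h : ∀ P : ModuleCat.{u} R, Module.FinitePresentation R P → ∀ f : moduleScheme P ⟶ M,
      PreservesDirectProducts (kernel f)) : IsML M := by
  refine ⟨inferInstance, hM, fun I S => (injective_iff_map_eq_zero _).2 fun y hy => ?_⟩
  obtain ⟨n, K, hK, φ, x, rfl⟩ := exists_finitelyPresented_rep hM y
  have : Module.FinitePresentation R ((Fin n → R) ⧸ K) :=
    Module.finitePresentation_of_surjective K.mkQ K.mkQ_surjective (by rwa [K.ker_mkQ])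
  refine map_eq_zero_of_preservesDirectProducts_kernel x (h _ this _) φ fun i => ?_
  rw [map_comp_apply]
  exact congrFun hy i

theorem preservesDirectProducts_kernel_of_isQuotientOfModuleScheme {N : ModuleCat.{u} R}
    (f : moduleScheme N ⟶ M) (h : IsQuotientOfModuleScheme (kernel f)) :
    PreservesDirectProducts (kernel f) := by
  obtain ⟨N', p, hp⟩ := h
  have hp' (S : ModuleCat.{u} R) : Function.Surjective (p.app S).hom :=
    (AddCommGrpCat.epi_iff_surjective (p.app S)).1 inferInstance
  refine fun I S => ⟨prodComparison_injective_of_injective (kernel.ι f)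
    (injective_app_of_mono (kernel.ι f)) (preservesDirectProducts_moduleScheme N I S).1,
    fun x => ?_⟩
  choose w hw using fun i => hp' (S i) (x i)
  obtain ⟨z, rfl⟩ := (preservesDirectProducts_moduleScheme N' I S).2 w
  refine ⟨(p.app _).hom z, funext fun i => ?_⟩
  rw [prodComparison_apply, ← app_map, ← hw, prodComparison_apply]

/-- A solution set for the maps out of `N` that kill `x ∈ M(N)`: each of them factors through one
that is given by a quotient of some `N × Rⁿ`. -/
theorem exists_factorization_of_map_eq_zero (hM : PreservesDirectLimits M) {N S : ModuleCat.{u} R}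
    (x : M.obj N) (φ : N ⟶ S) (hφ : (M.map φ).hom x = 0) :
    ∃ (n : ℕ) (K : Submodule R (N × (Fin n → R)))
      (ψ : ModuleCat.of R ((N × (Fin n → R)) ⧸ K) ⟶ S),
      (M.map (ModuleCat.ofHom (K.mkQ ∘ₗ LinearMap.inl R N (Fin n → R)))).hom x = 0 ∧
        ModuleCat.ofHom (K.mkQ ∘ₗ LinearMap.inl R N (Fin n → R)) ≫ ψ = φ := by
  classical
  -- `S` is the direct limit of the submodules that are finitely generated over the image of `φ`,
  -- and these are the images of the maps `N × Rⁿ → S` that extend `φ`.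
  let V : Finset S →o Submodule R S :=
    ⟨fun t => LinearMap.range φ.hom ⊔ Submodule.span R (t : Set S),
      fun s t h => sup_le_sup_left (Submodule.span_mono h) _⟩
  let φV (t : Finset S) : N ⟶ ModuleCat.of R (V t) :=
    ModuleCat.ofHom (φ.hom.codRestrict (V t) fun a => Submodule.mem_sup_left ⟨a, rfl⟩)
  obtain ⟨t, h_le, ht⟩ := (isElementwiseColimit_submodule hM V
    (fun s => ⟨{s}, Submodule.mem_sup_right (Submodule.subset_span (by simp))⟩)).exists_map_eq_zero
    ∅ ((M.map (φV ∅)).hom x)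
    ((map_comp_apply M (φV ∅) (ModuleCat.ofHom (V ∅).subtype) x).symm.trans hφ)
  have htx : (M.map (φV t)).hom x = 0 :=
    (map_comp_apply M (φV ∅) ((submoduleSystem V).map (homOfLE h_le)) x).trans ht
  obtain ⟨n, g, hg⟩ := Module.Finite.exists_fin' R (Submodule.span R (t : Set S))
  let π : N × (Fin n → R) →ₗ[R] S := φ.hom.coprod (Submodule.subtype _ ∘ₗ g)
  have hπ : V t = LinearMap.range π := by
    rw [LinearMap.range_coprod, LinearMap.range_comp, LinearMap.range_eq_top.2 hg,
      Submodule.map_top, Submodule.range_subtype]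
    rfl
  have hπ0 (a : N) : π (a, 0) = φ.hom a := by simp [π]
  let e : V t ≃ₗ[R] (N × (Fin n → R)) ⧸ LinearMap.ker π :=
    (LinearEquiv.ofEq _ _ hπ).trans π.quotKerEquivRange.symm
  have he : ModuleCat.ofHom ((LinearMap.ker π).mkQ ∘ₗ LinearMap.inl R N (Fin n → R)) =
      φV t ≫ ModuleCat.ofHom e.toLinearMap := by
    ext a
    refine π.quotKerEquivRange.injective (Subtype.ext ?_)
    change π (a, 0) = (π.quotKerEquivRange (π.quotKerEquivRange.symm _) : S)
    rw [LinearEquiv.apply_symm_apply]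
    exact hπ0 a
  refine ⟨n, LinearMap.ker π, ModuleCat.ofHom ((LinearMap.ker π).liftQ π le_rfl), ?_, ?_⟩
  · rw [he, map_comp_apply, htx, map_zero]
  · ext a
    exact hπ0 a

/-- If `θ : N → N'` is weakly universal among the maps out of `N` that kill `x ∈ M(N)`, then the
kernel of the morphism `𝓝^* → M` given by `x` is the image of `θ^* : 𝓝'^* → 𝓝^*`. -/
theorem isQuotientOfModuleScheme_kernel_of_weakly_universal [M.Additive] {N N' : ModuleCat.{u} R}
    (f : moduleScheme N ⟶ M) (θ : N ⟶ N')
    (hθ : (M.map θ).hom ((f.app N).hom (schemeEquiv N N (𝟙 N))) = 0)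
    (h : ∀ (S : ModuleCat.{u} R) (φ : N ⟶ S),
      (M.map φ).hom ((f.app N).hom (schemeEquiv N N (𝟙 N))) = 0 → ∃ χ : N' ⟶ S, θ ≫ χ = φ) :
    IsQuotientOfModuleScheme (kernel f) := by
  have : (kernel f).Additive := additive_of_injective _ (injective_app_of_mono (kernel.ι f))
  obtain ⟨k, hk⟩ := (exists_kernel_ι_eq_schemeEquiv_iff f θ).2 hθ
  refine ⟨N', schemeHom (kernel f) k, ?_⟩
  rw [NatTrans.epi_iff_epi_app]
  refine fun S => (AddCommGrpCat.epi_iff_surjective _).2 fun z => ?_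
  obtain ⟨φ, hφ⟩ := (schemeEquiv N S).surjective (((kernel.ι f).app S).hom z)
  obtain ⟨χ, hχ⟩ := h S φ ((exists_kernel_ι_eq_schemeEquiv_iff f φ).1 ⟨z, hφ.symm⟩)
  refine ⟨schemeEquiv N' S χ, injective_app_of_mono (kernel.ι f) S ?_⟩
  rw [schemeHom_app, app_map, hk, moduleScheme_map_schemeEquiv, hχ, hφ]

/-- The maps `N → S` that kill `x ∈ M(N)` have a solution set `(N → Qⱼ)`. When `M` is an ML module,
`N → ∏ Qⱼ` kills `x` as well, and hence is weakly universal. -/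
theorem IsML.isQuotientOfModuleScheme_kernel (hM : IsML M) {N : ModuleCat.{u} R}
    (f : moduleScheme N ⟶ M) : IsQuotientOfModuleScheme (kernel f) := by
  have := hM.additive
  let x := (f.app N).hom (schemeEquiv N N (𝟙 N))
  let J := {j : Σ n : ℕ, Submodule R (N × (Fin n → R)) //
    (M.map (ModuleCat.ofHom (j.2.mkQ ∘ₗ LinearMap.inl R N (Fin j.1 → R)))).hom x = 0}
  let Q (j : J) : ModuleCat.{u} R := ModuleCat.of R ((N × (Fin j.1.1 → R)) ⧸ j.1.2)
  let θ : N ⟶ ModuleCat.of R (∀ j, Q j) :=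
    ModuleCat.ofHom (LinearMap.pi fun j => j.1.2.mkQ ∘ₗ LinearMap.inl R N (Fin j.1.1 → R))
  refine isQuotientOfModuleScheme_kernel_of_weakly_universal f θ ?_ fun S φ hφ => ?_
  · refine hM.injective J Q ((funext fun j => ?_).trans (map_zero _).symm)
    rw [prodComparison_apply, ← map_comp_apply]
    exact j.2
  · obtain ⟨n, K, ψ, hK, hψ⟩ := exists_factorization_of_map_eq_zero hM.directLimits x φ hφ
    exact ⟨ModuleCat.ofHom (ψ.hom ∘ₗ LinearMap.proj (φ := fun j => Q j) ⟨⟨n, K⟩, hK⟩), hψ⟩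

end Kernels

/-! ### Direct limits of FP submodules -/

theorem IsDirectLimitOfFPSubmodules.isML {M : ModuleCat.{u} R ⥤ AddCommGrpCat.{u}} [M.Additive]
    (h : IsDirectLimitOfFPSubmodules M) : IsML M := by
  obtain ⟨J, _, _, _, F, ι, hF, hι, ⟨hc⟩⟩ := h
  have hinj (j : J) (S : ModuleCat.{u} R) : Function.Injective ((ι.app j).app S).hom :=
    have := hι j
    injective_app_of_mono (ι.app j) S
  have hsurj (S : ModuleCat.{u} R) (x : M.obj S) : ∃ j, ∃ y, ((ι.app j).app S).hom y = x :=
    ((nonempty_isColimit_iff _).1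
      ⟨isColimitOfPreserves ((evaluation _ AddCommGrpCat.{u}).obj S) hc⟩).exists_rep x
  refine ⟨inferInstance, ?_, fun I S => (injective_iff_map_eq_zero _).2 fun x hx => ?_⟩
  · rw [preservesDirectLimits_iff]
    intro I _ _ _ D c hD
    have hFc (j) := (preservesDirectLimits_iff (F.obj j)).1 (hF j).directLimits I D c hD
    refine ⟨fun x => ?_, fun i y hy => ?_⟩
    · obtain ⟨j, x, rfl⟩ := hsurj _ x
      obtain ⟨i, y, rfl⟩ := (hFc j).exists_rep x
      exact ⟨i, ((ι.app j).app _).hom y, (app_map (ι.app j) (c.ι.app i) y).symm⟩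
    · obtain ⟨j, y, rfl⟩ := hsurj _ y
      obtain ⟨k, hik, hk⟩ := (hFc j).exists_map_eq_zero i y
        (hinj j _ ((app_map (ι.app j) (c.ι.app i) y).trans (hy.trans (map_zero _).symm)))
      refine ⟨k, hik, (app_map (ι.app j) (D.map (homOfLE hik)) y).symm.trans ?_⟩
      exact (congrArg _ hk).trans (map_zero _)
  · obtain ⟨j, x, rfl⟩ := hsurj _ x
    suffices x = 0 by rw [this, map_zero]
    refine ((hF j).directProducts I S).1 (funext fun i => hinj j _ ?_)
    rw [prodComparison_apply, app_map, map_zero]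
    exact (congrFun hx i).trans (map_zero _).symm

section FPElement

variable (M : ModuleCat.{u} R ⥤ AddCommGrpCat.{u})

/-- An element of `M` over a finitely presented module. Finitely presented modules are taken in the
form `Rⁿ / K` with `K` finitely generated, which keeps this type in the universe of `R`. -/
structure FPElement : Type u where
  /-- The number of generators. -/
  n : ℕ
  /-- The module of relations. -/
  K : Submodule R (Fin n → R)
  fg : K.FG
  /-- The element. -/
  elt : M.obj (ModuleCat.of R ((Fin n → R) ⧸ K))

variable {M}

/-- The finitely presented module over which an element lives. -/
abbrev FPElement.base (x : FPElement M) : ModuleCat.{u} R := ModuleCat.of R ((Fin x.n → R) ⧸ x.K)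

instance (x : FPElement M) : Module.FinitePresentation R x.base :=
  Module.finitePresentation_of_surjective x.K.mkQ x.K.mkQ_surjective (by
    rw [x.K.ker_mkQ]
    exact x.fg)

/-- Elements are ordered by inclusion of the subfunctors that they generate. -/
instance : Preorder (FPElement M) where
  le x y := ∃ φ : y.base ⟶ x.base, (M.map φ).hom y.elt = x.elt
  le_refl x := ⟨𝟙 _, map_id_apply M _⟩
  le_trans x y z := by
    rintro ⟨φ, hφ⟩ ⟨ψ, hψ⟩
    exact ⟨ψ ≫ φ, by rw [map_comp_apply, hψ, hφ]⟩

theorem FPElement.exists_of_finitePresentation (P : ModuleCat.{u} R)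
    [Module.FinitePresentation R P] (x : M.obj P) :
    ∃ y : FPElement M, ∃ φ : y.base ⟶ P, (M.map φ).hom y.elt = x := by
  obtain ⟨n, K, e, hK⟩ := Module.FinitePresentation.exists_fin R P
  refine ⟨⟨n, K, hK, (M.map (ModuleCat.ofHom e.toLinearMap)).hom x⟩,
    ModuleCat.ofHom e.symm.toLinearMap, ?_⟩
  rw [← map_comp_apply, ← ModuleCat.ofHom_comp]
  simp

instance : Nonempty (FPElement M) := ⟨⟨0, ⊥, Submodule.fg_bot, 0⟩⟩

end FPElement

section Generated

variable (M : ModuleCat.{u} R ⥤ AddCommGrpCat.{u}) [M.Additive]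

/-- The subfunctor of `M` generated by `x ∈ M(P)`: the image of the morphism `𝓟^* → M` given by
`x`. -/
def generated {P : ModuleCat.{u} R} (x : M.obj P) : ModuleCat.{u} R ⥤ AddCommGrpCat.{u} where
  obj S := AddCommGrpCat.of (evalHom M x S).range
  map {S T} ψ := AddCommGrpCat.ofHom (((M.map ψ).hom.comp (evalHom M x S).range.subtype).codRestrict
    (evalHom M x T).range (by
      rintro ⟨_, φ, rfl⟩
      exact ⟨φ ≫ ψ, map_comp_apply M φ ψ x⟩))
  map_id S := by
    ext y
    exact map_id_apply M y.1
  map_comp f g := by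
    ext y
    exact map_comp_apply M f g y.1

/-- The inclusion of the subfunctor generated by an element. -/
def generatedι {P : ModuleCat.{u} R} (x : M.obj P) : generated M x ⟶ M where
  app S := AddCommGrpCat.ofHom (evalHom M x S).range.subtype

variable {M}

theorem generatedι_injective {P : ModuleCat.{u} R} (x : M.obj P) (S : ModuleCat.{u} R) :
    Function.Injective ((generatedι M x).app S).hom :=
  Subtype.val_injective

theorem exists_generatedι_eq_iff {P : ModuleCat.{u} R} (x : M.obj P) {S : ModuleCat.{u} R}
    (z : M.obj S) : (∃ y, ((generatedι M x).app S).hom y = z) ↔ ∃ φ : P ⟶ S, (M.map φ).hom x = z :=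
  ⟨fun ⟨y, hy⟩ => hy ▸ y.2, fun h => ⟨⟨z, h⟩, rfl⟩⟩

/-- For an ML module `M` and a finitely presented `P`, the subfunctor generated by `x ∈ M(P)` is an
FP module: maps out of `P` factor through a stage of any direct limit, and families of maps
`P → Sᵢ` are maps `P → ∏ Sᵢ`. -/
theorem IsML.isFP_generated (hM : IsML M) {P : ModuleCat.{u} R} [Module.FinitePresentation R P]
    (x : M.obj P) : IsFP (generated M x) := by
  have hι := generatedι_injective x
  refine ⟨additive_of_injective (generatedι M x) hι,
    preservesDirectLimits_of_injective hM.directLimits (generatedι M x) hι ?_, fun I S =>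
    ⟨prodComparison_injective_of_injective (generatedι M x) hι (hM.injective I S), fun y => ?_⟩⟩
  · intro I _ _ _ D c hc y
    obtain ⟨φ, hφ⟩ := (exists_generatedι_eq_iff x _).1 ⟨y, rfl⟩
    obtain ⟨i, ψ, rfl⟩ := exists_comp_ι_eq hc P φ
    obtain ⟨z, hz⟩ := (exists_generatedι_eq_iff x _).2 ⟨ψ, rfl⟩
    refine ⟨i, z, hι _ ?_⟩
    rw [app_map, hz, ← map_comp_apply]
    exact hφ
  · choose φ hφ using fun i => (exists_generatedι_eq_iff x _).1 ⟨y i, rfl⟩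
    obtain ⟨z, hz⟩ := (exists_generatedι_eq_iff x _).2
      ⟨(ModuleCat.ofHom (LinearMap.pi fun i => (φ i).hom) : P ⟶ ModuleCat.of R (∀ i, S i)), rfl⟩
    refine ⟨z, funext fun i => hι _ ?_⟩
    rw [prodComparison_apply, app_map, hz, ← map_comp_apply]
    exact hφ i

/-- By additivity, `x ∈ M(P)` and `y ∈ M(Q)` are both images of an element of `M(P × Q)`. -/
instance : IsDirectedOrder (FPElement M) where
  directed x y := by
    let inl : x.base ⟶ ModuleCat.of R (x.base × y.base) := ModuleCat.ofHom (LinearMap.inl R _ _)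
    let inr : y.base ⟶ ModuleCat.of R (x.base × y.base) := ModuleCat.ofHom (LinearMap.inr R _ _)
    let fst : ModuleCat.of R (x.base × y.base) ⟶ x.base := ModuleCat.ofHom (LinearMap.fst R _ _)
    let snd : ModuleCat.of R (x.base × y.base) ⟶ y.base := ModuleCat.ofHom (LinearMap.snd R _ _)
    obtain ⟨z, φ, hz⟩ := FPElement.exists_of_finitePresentation
      (ModuleCat.of R (x.base × y.base)) ((M.map inl).hom x.elt + (M.map inr).hom y.elt)
    have h1 : inl ≫ fst = 𝟙 _ := rfl
    have h2 : inr ≫ fst = 0 := rfl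
    have h3 : inl ≫ snd = 0 := rfl
    have h4 : inr ≫ snd = 𝟙 _ := rfl
    refine ⟨z, ⟨φ ≫ fst, ?_⟩, ⟨φ ≫ snd, ?_⟩⟩
    · rw [map_comp_apply, hz, map_add, ← map_comp_apply, ← map_comp_apply, h1, h2, map_id_apply,
        M.map_zero]
      exact add_zero _
    · rw [map_comp_apply, hz, map_add, ← map_comp_apply, ← map_comp_apply, h3, h4, map_id_apply,
        M.map_zero]
      exact zero_add _

theorem FPElement.range_evalHom_le {x y : FPElement M} (h : x ≤ y) (S : ModuleCat.{u} R) :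
    (evalHom M x.elt S).range ≤ (evalHom M y.elt S).range := by
  obtain ⟨φ, hφ⟩ := h
  rintro _ ⟨ψ, rfl⟩
  refine ⟨φ ≫ ψ, (map_comp_apply M φ ψ y.elt).trans ?_⟩
  rw [hφ]
  rfl

variable (M)

/-- The direct system of the subfunctors of `M` generated by elements over finitely presented
modules. -/
def generatedSystem : FPElement M ⥤ (ModuleCat.{u} R ⥤ AddCommGrpCat.{u}) where
  obj x := generated M x.elt
  map f :=
    { app := fun S => AddCommGrpCat.ofHom
        (AddSubgroup.inclusion (FPElement.range_evalHom_le (leOfHom f) S)) }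

/-- The inclusions of the subfunctors generated by elements over finitely presented modules. -/
def generatedSystemι : generatedSystem M ⟶ (Functor.const (FPElement M)).obj M where
  app x := generatedι M x.elt

variable {M}

theorem IsML.isDirectLimitOfFPSubmodules (hM : IsML M) : IsDirectLimitOfFPSubmodules M := by
  refine ⟨FPElement M, inferInstance, inferInstance, inferInstance, generatedSystem M,
    generatedSystemι M, fun x => hM.isFP_generated x.elt, fun x => ?_, ⟨?_⟩⟩
  · rw [NatTrans.mono_iff_mono_app]
    exact fun S => (AddCommGrpCat.mono_iff_injective _).2 (generatedι_injective x.elt S)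
  · refine evaluationJointlyReflectsColimits _ fun S => Nonempty.some ?_
    refine (nonempty_isColimit_iff _).2 ⟨fun z => ?_, fun x y hy => ⟨x, le_rfl, ?_⟩⟩
    · obtain ⟨n, K, hK, φ, x, rfl⟩ := exists_finitelyPresented_rep hM.directLimits z
      exact ⟨⟨n, K, hK, x⟩, (exists_generatedι_eq_iff x _).2 ⟨φ, rfl⟩⟩
    · have h0 : y = 0 := generatedι_injective x.elt S (hy.trans (map_zero _).symm)
      rw [h0, map_zero]

end Generated

end

end RMod

theorem mainTheorem2 {R : Type u} [Ring R] (M : ModuleCat.{u} R ⥤ AddCommGrpCat.{u})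
    [M.Additive] :
    (RMod.IsML M ↔ RMod.IsDirectLimitOfFPSubmodules M) ∧
    (RMod.PreservesDirectLimits M →
      List.TFAE [
        RMod.IsML M,
        RMod.IsDirectLimitOfFPSubmodules M,
        ∀ (F : ModuleCat.{u} R ⥤ AddCommGrpCat.{u}), RMod.IsFP F →
          ∀ f : F ⟶ M, RMod.IsFP (kernel f),
        ∀ (N : ModuleCat.{u} R) (f : RMod.moduleScheme N ⟶ M),
          RMod.IsQuotientOfModuleScheme (kernel f),
        ∀ (N : ModuleCat.{u} R) (f : RMod.moduleScheme N ⟶ M),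
          RMod.PreservesDirectProducts (kernel f)]) := by
  refine ⟨⟨fun h => h.isDirectLimitOfFPSubmodules, fun h => h.isML⟩, fun hM => ?_⟩
  tfae_have 1 → 2 := fun h => h.isDirectLimitOfFPSubmodules
  tfae_have 2 → 1 := fun h => h.isML
  tfae_have 1 → 3 := fun h F hF f => h.isFP_kernel hF f
  tfae_have 3 → 1 := fun h => RMod.isML_of_preservesDirectProducts_kernel hM fun P _ f =>
    (h _ (RMod.isFP_moduleScheme P) f).directProducts
  tfae_have 1 → 4 := fun h N f => h.isQuotientOfModuleScheme_kernel f
  tfae_have 4 → 5 := fun h N f =>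
    RMod.preservesDirectProducts_kernel_of_isQuotientOfModuleScheme f (h N f)
  tfae_have 5 → 1 := fun h =>
    RMod.isML_of_preservesDirectProducts_kernel hM fun P _ f => h P f
  tfae_finish
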